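/- Let $W$ and $M$ be disjoint finite nonempty sets (of women and men) with $|W|=|M|=n$. A preference list of a participant is a totally ordered subset of the opposite side, and the participant's blacklist is the set of members of the opposite side that are not in this list; a profile $\mathcal{P}_W$ (resp. $\mathcal{P}_M$) specifies a preference list for each woman (resp. man), and $B_w(\mathcal{P}_W)$ denotes the blacklist of $w\in W$. A matching is a one-to-one mapping between a subset of $W$ and a subset of $M$; it is perfect if every participant is matched, and $M$-rational (resp. $W$-rational) if no man (resp. woman) is matched with someone from his (resp. her) blacklist. It is stable if it is both $W$-rational and $M$-rational and there are no woman and man who do not blacklist each other and each of whom is either unmatched or prefers the other over the assigned partner. Let $\mathcal{P}_M$ be a profile of preference lists for $M$ and let $\mu$ be an $M$-rational perfect matching. Then there exists a profile $\mathcal{P}_W$ of preference lists for $W$ such that 1. the only stable matching, given $\mathcal{P}_W$ and $\mathcal{P}_M$, is $\mu$; 2. the blacklists in $\mathcal{P}_W$ are pairwise disjoint; 3. the number $n_b$ of women who have nonempty blacklists in $\mathcal{P}_W$ is at most $\lfloor n/2\rfloor$; 4. $\sum_{w\in W}|B_w(\mathcal{P}_W)|\le n-n_b$; and, moreover, the combined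 size of all blacklists satisfies $$\sum_{w\in W}|B_w(\mathcal{P}_W)|\le n-1,$$ i.e. the average blacklist size $\frac1n\sum_{w\in W}|B_w(\mathcal{P}_W)|$ is less than $1$. -/

import Mathlib

namespace StableMatching

/-- A preference list over `B`: a totally ordered (finite) subset of `B`, listed without
repetitions from the most preferred element to the least preferred one. -/
@[ext]
structure PrefList (B : Type*) where
  /-- the acceptable elements, most preferred first -/
  toList : List B
  /-- no element is listed twice -/
  nodup : toList.Nodup

/-- `L.Prefers a b`: the element `a` appears in `L` strictly before `b`. (`List.idxOf` of an element
that is not in the list is the length of the list, so that every listed element is preferred over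
every unlisted one, and no unlisted element is preferred over anything.) -/
def PrefList.Prefers {B : Type*} (L : PrefList B) (a b : B) : Prop :=
  open Classical in L.toList.idxOf a < L.toList.idxOf b

/-- A profile of preference lists for the side `A`: one preference list over the opposite side `B`
for each member of `A`. -/
abbrev Profile (A B : Type*) := A → PrefList B

/-- The blacklist of `a`: all members of the opposite side that are not in `a`'s preference list. -/
noncomputable def blacklist {A B : Type*} [Fintype B] (P : Profile A B) (a : A) : Finset B :=
  open Classical in Finset.univ.filter fun b => b ∉ (P a).toList

/-- The combined size of all blacklists in a profile. -/
noncomputable def combinedSize {A B : Type*} [Fintype A] [Fintype B] (P : Profile A B) : ℕ :=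
  ∑ a, (blacklist P a).card

/-- The number of participants who have nonempty blacklists in a profile. -/
noncomputable def numNonempty {A B : Type*} [Fintype A] [Fintype B] (P : Profile A B) : ℕ :=
  (Finset.univ.filter fun a => (blacklist P a).Nonempty).card

/-- A matching between `W` and `M`: a one-to-one mapping between a subset of `W` and a subset
of `M`. Here `μ w = none` means that `w` is unmatched; `μ.symm m` is the partner of `m`, if any. -/
abbrev Matching (W M : Type*) := W ≃. M

/-- A matching is perfect if no participant, on either side, is unmatched. -/
def IsPerfect {W M : Type*} (μ : Matching W M) : Prop :=
  (∀ w, ∃ m, μ w = some m) ∧ ∀ m, ∃ w, μ.symm m = some w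

/-- No participant of the side `A` is matched with someone from their own blacklist.
For a matching `μ : Matching W M`, `W`-rationality is `IsRational PW μ` and
`M`-rationality is `IsRational PM μ.symm`. -/
def IsRational {A B : Type*} [Fintype B] (P : Profile A B) (μ : Matching A B) : Prop :=
  ∀ a b, μ a = some b → b ∉ blacklist P a

/-- `a` is unmatched in `μ`, or prefers `b` over the partner matched to `a` by `μ`. -/
def WouldSwitch {A B : Type*} (P : Profile A B) (μ : Matching A B) (a : A) (b : B) : Prop :=
  μ a = none ∨ ∃ b', μ a = some b' ∧ (P a).Prefers b b'

/-- `μ` is unstable: it is not `W`-rational, or not `M`-rational, or there are a woman and a man who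
do not blacklist each other, each of whom is either unmatched or prefers the other over the partner
matched to them. -/
def IsUnstable {W M : Type*} [Fintype W] [Fintype M] (PW : Profile W M) (PM : Profile M W)
    (μ : Matching W M) : Prop :=
  ¬ IsRational PW μ ∨ ¬ IsRational PM μ.symm ∨
    ∃ w m, m ∉ blacklist PW w ∧ w ∉ blacklist PM m ∧
      WouldSwitch PW μ w m ∧ WouldSwitch PM μ.symm m w

/-- A matching is stable if it is not unstable. -/
def IsStable {W M : Type*} [Fintype W] [Fintype M] (PW : Profile W M) (PM : Profile M W)
    (μ : Matching W M) : Prop :=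
  ¬ IsUnstable PW PM μ

end StableMatching

/-!
Identify each woman with her partner under `μ`, so that both sides become one finite type `α`, the
pair `(m, x)` means "man `m` and the partner of man `x`", and the goal is to make every man end with
himself. The lists of the women are found by running a men-proposing deferred acceptance in which
the women decide adaptively whom to reject. The state is the list `L` of rejected pairs (latest
first), the set `B ⊆ L` of blacklisted pairs, and the map `f : α → α` sending each man to the best
choice that has not rejected him (`Points`). Nobody is ever rejected by his own partner.

*Uniqueness from a run.* Suppose each rejection of `m` by `x` is either a blacklisting, or is
justified by another man pointing at `x` who is not blacklisted by her (`Justified`). Let each woman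
rank her partner first, then the men she did not reject, then the later rejected before the earlier
rejected. By induction on time no rejected pair occurs in a stable matching
(`IsStable.ne_of_mem`); so once `f = id`, every man does no better than `μ` in a stable matching.
He does no worse either, as he is the first choice of his partner. Hence `μ` is the only stable
matching (`isStable_iff_eq`).

*The run.* Call a node clean if it has rejected nobody. Whenever two men point at `y`, one
is rejected; if `y` lies on a cycle of length at least `2` of `f`, it is the predecessor of `y` on
it, so that this cycle is broken (`exists_breaksCycle`). A cycle created by a rejection goes
through the new target of the rejected man, which is either clean or already pointed at by somebody
else. So every nontrivial cycle keeps a node which is clean or has two preimages (`Guarded.reject`).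
When no collisions are left, `f` is a permutation and every nontrivial cycle has a clean node
(`exists_resting`). Choose such a clean `c`. She blacklists whoever points at her, other than
herself, and collisions elsewhere are treated as before, until `f c = c`. Since `c` has rejected
only by blacklisting, no earlier justification is spoilt. All nodes but `c` keep a preimage, and the
men blacklisted by `c` are either fixed points of `f` or on the path of `f` that starts at `c`
(`Active`, `Active.exists_cons`); when `f c = c` they are therefore fixed and are never rejected
again (`Active.resting`). This is repeated with another clean node until `f = id`
(`exists_rejections`).

*Counting.* Each man is blacklisted at most once, and the partner of a blacklisting woman never is.
So the number of blacklisted men plus the number `n_b` of blacklisting women is at most `n`, while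
`n_b` is at most the number of blacklisted men (`card_blacklists`); all bounds follow.
-/

namespace StableMatching

/-! ### Lists of justified rejections -/

variable {α : Type*}

/-- `L` lists rejections `(m, x)` of `m` by `x`, latest first. Each one is a blacklisting (an element
of `B`) or is justified by another man `m'` whom `x` neither has rejected so far nor blacklists: `x`
is acceptable to `m'`, being at least as good as his own partner `m'`, and everybody he
likes better has already rejected him. Lower values of `ρ m` are better. -/
inductive Justified (ρ : α → α → ℕ) (B : Set (α × α)) : List (α × α) → Prop
  | nil : Justified ρ B []
  | cons {L : List (α × α)} {m x : α} : Justified ρ B L → (m, x) ∉ L → m ≠ x →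
      ((m, x) ∈ B ∨ ∃ m', m' ≠ m ∧ (m', x) ∉ L ∧ (m', x) ∉ B ∧ ρ m' x ≤ ρ m' m' ∧
        ∀ z, ρ m' z < ρ m' x → (m', z) ∈ L) →
      Justified ρ B ((m, x) :: L)

theorem Justified.nodup {ρ : α → α → ℕ} {B : Set (α × α)} {L : List (α × α)}
    (h : Justified ρ B L) : L.Nodup := by
  induction h with
  | nil => exact List.nodup_nil
  | cons _ hn _ _ ih => exact List.nodup_cons.2 ⟨hn, ih⟩

theorem Justified.diag_notMem {ρ : α → α → ℕ} {B : Set (α × α)} {L : List (α × α)}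
    (h : Justified ρ B L) : ∀ m, (m, m) ∉ L := by
  induction h with
  | nil => simp
  | cons _ _ hne _ ih =>
    intro a ha
    rcases List.mem_cons.1 ha with h | h
    · simp only [Prod.mk.injEq] at h
      exact hne (h.1.symm.trans h.2)
    · exact ih a h

/-- A woman who so far has rejected only by blacklisting may blacklist further men: she is not
involved in any justification that uses a man not on her blacklist. -/
theorem Justified.insert {ρ : α → α → ℕ} {B : Set (α × α)} {L : List (α × α)}
    (h : Justified ρ B L) {c : α} (hc : ∀ x, (x, c) ∈ L → (x, c) ∈ B) (m : α) :
    Justified ρ (insert (m, c) B) L := by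
  induction h with
  | nil => exact .nil
  | @cons L a x h hn hne hw ih =>
    refine .cons (ih fun y hy => hc y (List.mem_cons_of_mem _ hy)) hn hne ?_
    rcases hw with hw | ⟨m', h1, h2, h3, h4⟩
    · exact Or.inl (Set.mem_insert_of_mem _ hw)
    · by_cases hx : x = c
      · subst hx
        exact Or.inl (Set.mem_insert_of_mem _ (hc a List.mem_cons_self))
      · refine Or.inr ⟨m', h1, h2, ?_, h4⟩
        rintro (h | h)
        · exact hx (congrArg Prod.snd h)
        · exact h3 h

/-! ### Breaking the cycles of the pointing map -/

/-- `x` has rejected nobody. -/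
def Clean (L : List (α × α)) (x : α) : Prop := ∀ m, (m, x) ∉ L

/-- `f` sends each man to a best choice that has not rejected him. -/
def Points (ρ : α → α → ℕ) (L : List (α × α)) (f : α → α) : Prop :=
  ∀ m, (m, f m) ∉ L ∧ ∀ z, (m, z) ∉ L → ρ m (f m) ≤ ρ m z

/-- Every nontrivial cycle of `f` disjoint from `E` contains a node that is clean or has two
preimages. Instead of cycles, this speaks of sets closed under `f` and without fixed points: each
such set contains a nontrivial cycle, and each such cycle is such a set. -/
def Guarded (E : Set α) (L : List (α × α)) (f : α → α) : Prop :=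
  ∀ S : Set α, S.Nonempty → Set.MapsTo f S S → (∀ x ∈ S, f x ≠ x) → Disjoint S E →
    ∃ x ∈ S, Clean L x ∨ ∃ a b, a ≠ b ∧ f a = x ∧ f b = x

/-- If `y` lies on a cycle of `f` of length at least `2`, then `m` lies on that cycle too: either
`y` is fixed, or `m` is in the forward orbit of `y`, or `y` is not periodic. For `f m = y` this says
that redirecting `m` destroys every nontrivial cycle through `y`. -/
def BreaksCycle (f : α → α) (m y : α) : Prop :=
  f y = y ∨ (∀ S : Set α, Set.MapsTo f S S → y ∈ S → m ∈ S) ∨ y ∉ Function.periodicPts f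

theorem exists_breaksCycle {f : α → α} {a b y : α} (hab : a ≠ b) (ha : f a = y) (hb : f b = y) :
    ∃ m m', m ≠ m' ∧ m ≠ y ∧ f m = y ∧ f m' = y ∧ BreaksCycle f m y := by
  have other : ∀ m, ∃ m', m ≠ m' ∧ f m' = y := fun m => by
    by_cases h : m = a
    · exact ⟨b, h ▸ hab, hb⟩
    · exact ⟨a, h, ha⟩
  by_cases hp : f y ≠ y ∧ y ∈ Function.periodicPts f
  · obtain ⟨hy, k, hk, hper⟩ := hp
    obtain ⟨j, rfl⟩ : ∃ j, k = j + 1 := ⟨k - 1, by omega⟩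
    have hfm : f (f^[j] y) = y := by
      rw [← Function.iterate_succ_apply' f j y]
      exact hper
    obtain ⟨m', h1, h2⟩ := other (f^[j] y)
    refine ⟨f^[j] y, m', h1, fun h => hy ?_, hfm, h2, Or.inr (Or.inl fun S hS hyS => ?_)⟩
    · rwa [h] at hfm
    · exact hS.iterate j hyS
  · have hbr : ∀ m, BreaksCycle f m y := fun m => by
      by_cases h : f y = y
      · exact Or.inl h
      · exact Or.inr (Or.inr fun h' => hp ⟨h, h'⟩)
    by_cases h : a = y
    · exact ⟨b, a, hab.symm, fun hby => hab (h.trans hby.symm), hb, ha, hbr b⟩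
    · exact ⟨a, b, hab, h, ha, hb, hbr a⟩

/-- The guard condition survives the rejection of `m` by `y` and the redirection of `m`. A closed set
that contains `m` contains its new target, which is clean or has another preimage; on a set without
`m` nothing changes except the status of `y`, and `y` is on no cycle inside such a set. -/
theorem Guarded.reject {E : Set α} {L : List (α × α)} {f f' : α → α} {m y : α}
    (hG : Guarded E L f) (hE : ∀ x, x ∉ E → ¬ Clean L x → ∃ a, f a = x)
    (hm : f m = y) (hy : y ∈ E ∨ BreaksCycle f m y)
    (hm' : f' m ≠ y) (hf' : ∀ a, a ≠ m → f' a = f a) :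
    Guarded E ((m, y) :: L) f' := by
  have clean : ∀ x, x ≠ y → Clean L x → Clean ((m, y) :: L) x := by
    intro x hx hc a ha
    rcases List.mem_cons.1 ha with h | h
    · exact hx (congrArg Prod.snd h)
    · exact hc a h
  intro S hne hS hfix hdis
  by_cases hmS : m ∈ S
  · refine ⟨f' m, hS hmS, ?_⟩
    by_cases hc : Clean L (f' m)
    · exact Or.inl (clean _ hm' hc)
    · obtain ⟨a, ha⟩ := hE _ (fun h => Set.disjoint_left.1 hdis (hS hmS) h) hc
      have ham : a ≠ m := by
        rintro rfl
        exact hm' (ha.symm.trans hm)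
      exact Or.inr ⟨a, m, ham, (hf' a ham).trans ha, rfl⟩
  · have heq : ∀ a ∈ S, f' a = f a := fun a ha => hf' a fun h => hmS (h ▸ ha)
    have hSf : Set.MapsTo f S S := fun a ha => heq a ha ▸ hS ha
    have hfixf : ∀ a ∈ S, f a ≠ a := fun a ha => heq a ha ▸ hfix a ha
    have fin : ∀ x ∈ S, x ≠ y → (Clean L x ∨ ∃ a b, a ≠ b ∧ f a = x ∧ f b = x) →
        ∃ x ∈ S, Clean ((m, y) :: L) x ∨ ∃ a b, a ≠ b ∧ f' a = x ∧ f' b = x := by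
      rintro x hxS hxy (hc | ⟨a, b, hab, ha, hb⟩)
      · exact ⟨x, hxS, Or.inl (clean x hxy hc)⟩
      · have key : ∀ a, f a = x → f' a = x := fun a ha => by
          rw [hf' a, ha]
          rintro rfl
          exact hxy (ha.symm.trans hm)
        exact ⟨x, hxS, Or.inr ⟨a, b, hab, key a ha, key b hb⟩⟩
    by_cases hyS : y ∈ S
    · rcases hy with hyE | hfy | hcyc | hper
      · exact absurd hyE (Set.disjoint_left.1 hdis hyS)
      · exact absurd hfy (hfixf y hyS)
      · exact absurd (hcyc S hSf hyS) hmS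
      -- the part of `S` strictly after the non-periodic `y` is closed and avoids `y`
      · have hsub : Set.range (fun k => f^[k + 1] y) ⊆ S := by
          rintro _ ⟨k, rfl⟩
          exact hSf.iterate (k + 1) hyS
        obtain ⟨x, ⟨k, rfl⟩, hx⟩ := hG (Set.range fun k => f^[k + 1] y) ⟨_, 0, rfl⟩
          (by
            rintro _ ⟨k, rfl⟩
            exact ⟨k + 1, Function.iterate_succ_apply' f (k + 1) y⟩)
          (fun x hx => hfixf x (hsub hx)) (hdis.mono_left hsub)
        refine fin _ (hsub ⟨k, rfl⟩) (fun h => hper ⟨k + 1, k.succ_pos, h⟩) hx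
    · obtain ⟨x, hxS, hx⟩ := hG S hne hSf hfixf hdis
      exact fin x hxS (fun h => hyS (h ▸ hxS)) hx

theorem Points.reject [Finite α] {ρ : α → α → ℕ} {L : List (α × α)} {f : α → α}
    (hP : Points ρ L f) {m : α} (hmm : (m, m) ∉ L) (hm : f m ≠ m) :
    ∃ f' : α → α, Points ρ ((m, f m) :: L) f' ∧ f' m ≠ f m ∧ ∀ a, a ≠ m → f' a = f a := by
  classical
  obtain ⟨z, hz, hmin⟩ := Set.exists_min_image {z | (m, z) ∉ (m, f m) :: L} (ρ m)
    (Set.toFinite _) ⟨m, by simp [hmm, hm.symm]⟩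
  have hz' : z ≠ f m ∧ (m, z) ∉ L := by simpa using hz
  refine ⟨Function.update f m z, fun a => ?_, by simpa using hz'.1,
    fun a ha => Function.update_of_ne ha _ _⟩
  by_cases ha : a = m
  · subst ha
    simpa using ⟨hz', fun w h1 h2 => hmin w (by simp [h1, h2])⟩
  · simpa [ha] using hP a

theorem Points.initial [Finite α] (ρ : α → α → ℕ) : ∃ f : α → α, Points ρ [] f := by
  have h : ∀ m, ∃ x, ∀ z, ρ m x ≤ ρ m z := fun m => by
    obtain ⟨x, -, hx⟩ := Set.exists_min_image Set.univ (ρ m) (Set.toFinite _) ⟨m, trivial⟩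
    exact ⟨x, fun z => hx z trivial⟩
  choose f hf using h
  exact ⟨f, fun m => ⟨by simp, fun z _ => hf m z⟩⟩

theorem Points.mem {ρ : α → α → ℕ} {L : List (α × α)} {f : α → α} (hP : Points ρ L f) {m z : α}
    (h : ρ m z < ρ m (f m)) : (m, z) ∈ L := by
  by_contra hz
  exact absurd ((hP m).2 z hz) (not_le.2 h)

theorem Justified.cons_of_collision {ρ : α → α → ℕ} {B : Set (α × α)} {L : List (α × α)}
    {f : α → α} (hJ : Justified ρ B L) (hP : Points ρ L f) (hB : ∀ p ∈ B, p ∈ L) {m m' y : α}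
    (hmm' : m ≠ m') (hmy : m ≠ y) (hm : f m = y) (hm' : f m' = y) :
    Justified ρ B ((m, y) :: L) := by
  have h' : (m', y) ∉ L := hm' ▸ (hP m').1
  exact .cons hJ (hm ▸ (hP m).1) hmy (Or.inr ⟨m', hmm'.symm, h', fun h => h' (hB _ h),
    hm' ▸ (hP m').2 m' (hJ.diag_notMem m'), fun z hz => hP.mem (hm'.symm ▸ hz)⟩)

/-! ### The run -/

/-- A state of the run: justified rejections `L`, blacklisted pairs `B`, and the pointing map `f`.
No man is blacklisted twice, and no blacklisting node is itself blacklisted. -/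
structure Rejections (ρ : α → α → ℕ) (B : Set (α × α)) (L : List (α × α)) (f : α → α) :
    Prop where
  justified : Justified ρ B L
  points : Points ρ L f
  subset : ∀ p ∈ B, p ∈ L
  fst_inj : ∀ m x y, (m, x) ∈ B → (m, y) ∈ B → x = y
  fst_notMem_snd : ∀ m x y, (m, x) ∈ B → (x, y) ∉ B

/-- A state without collisions, in which everybody involved in a blacklisting is a fixed point, so
that every nontrivial cycle of the permutation `f` consists of men not yet involved and contains a
clean node. -/
structure Resting (ρ : α → α → ℕ) (B : Set (α × α)) (L : List (α × α)) (f : α → α) : Prop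
    extends Rejections ρ B L f where
  surj : Function.Surjective f
  guarded : Guarded ∅ L f
  fixed : ∀ m x, (m, x) ∈ B → f m = m ∧ f x = x

/-- A state of the phase in which `c` is the blacklisting node: `c` is the only node that may lack a
preimage, and has rejected only by blacklisting. The men blacklisted by `c` are fixed points or in the forward
orbit of `c`, the latter expressed by membership in all closed sets containing `c`. -/
structure Active (ρ : α → α → ℕ) (c : α) (B : Set (α × α)) (L : List (α × α)) (f : α → α) : Prop
    extends Rejections ρ B L f where
  mem_range : ∀ x, x ≠ c → ∃ a, f a = x
  guarded : Guarded {c} L f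
  fixed : ∀ m x, (m, x) ∈ B → x ≠ c → f m = m ∧ f x = x
  mem_of_mem : ∀ m, (m, c) ∈ L → (m, c) ∈ B
  reach : ∀ m, (m, c) ∈ B → f m = m ∨ ∀ S : Set α, Set.MapsTo f S S → c ∈ S → m ∈ S

/-- Collisions can be resolved without blacklists. The invariant, besides the guard condition, is that
every node which has rejected somebody keeps a preimage. -/
theorem exists_resting [Fintype α] (ρ : α → α → ℕ) : ∃ L f, Resting ρ ∅ L f := by
  have main : ∀ k, ∀ L f, Fintype.card (α × α) < L.length + k → Justified ρ ∅ L → Points ρ L f →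
      Guarded ∅ L f → (∀ x, ¬ Clean L x → ∃ a, f a = x) → ∃ L f, Resting ρ ∅ L f := by
    -- `L` has no duplicates, so the number `k` of further rejections is bounded
    intro k
    induction k with
    | zero => exact fun L f hk hJ => absurd hJ.nodup.length_le_card (not_le.2 hk)
    | succ k ih =>
      intro L f hk hJ hP hG hr
      by_cases hinj : Function.Injective f
      · exact ⟨L, f, ⟨hJ, hP, by simp, by simp, by simp⟩, Finite.injective_iff_surjective.1 hinj,
          hG, by simp⟩
      obtain ⟨a, b, hfab, hab⟩ : ∃ a b, f a = f b ∧ a ≠ b := by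
        simpa [Function.Injective] using hinj
      obtain ⟨m, m', hmm', hmy, hm, hm', hbr⟩ := exists_breaksCycle hab hfab rfl
      obtain ⟨f', hP', hf'm, hf'⟩ := hP.reject (hJ.diag_notMem m) (hm.trans_ne hmy.symm)
      rw [hm] at hP' hf'm
      refine ih _ f' (by rw [List.length_cons]; omega)
        (hJ.cons_of_collision hP (by simp) hmm' hmy hm hm') hP'
        (hG.reject (fun x _ => hr x) hm (Or.inr hbr) hf'm hf') fun x hx => ?_
      by_cases hxy : x = f b
      · exact ⟨m', (hf' m' hmm'.symm).trans (hm'.trans hxy.symm)⟩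
      · obtain ⟨a, ha⟩ := hr x fun hc => hx fun z hz => by
          rcases List.mem_cons.1 hz with h | h
          · exact hxy (congrArg Prod.snd h)
          · exact hc z h
        exact ⟨a, (hf' a (by rintro rfl; exact hxy (ha.symm.trans hm))).trans ha⟩
  obtain ⟨f, hf⟩ := Points.initial ρ
  exact main (Fintype.card (α × α) + 1) [] f (by simp) .nil hf
    (fun S ⟨x, hx⟩ _ _ _ => ⟨x, hx, Or.inl fun m => by simp⟩)
    (fun x hx => absurd (fun m => by simp) hx)

theorem Active.resting {ρ : α → α → ℕ} {c : α} {B : Set (α × α)} {L : List (α × α)} {f : α → α}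
    (h : Active ρ c B L f) (hc : f c = c) : Resting ρ B L f where
  toRejections := h.toRejections
  surj x := (eq_or_ne x c).elim (fun hx => ⟨c, hc.trans hx.symm⟩) (h.mem_range x)
  guarded S hne hS hfix _ := h.guarded S hne hS hfix
    (Set.disjoint_singleton_right.2 fun hcS => hfix c hcS hc)
  fixed m x hmx := by
    by_cases hx : x = c
    · subst hx
      refine ⟨(h.reach m hmx).elim id fun hr => ?_, hc⟩
      obtain rfl : m = x := hr {x} (by simpa using hc) rfl
      exact hc
    · exact h.fixed m x hmx hx

theorem Resting.exists_active {ρ : α → α → ℕ} {B : Set (α × α)} {L : List (α × α)} {f : α → α}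
    (h : Resting ρ B L f) [Finite α] (hf : ∃ x, f x ≠ x) : ∃ c, f c ≠ c ∧ Active ρ c B L f := by
  have hinj : Function.Injective f := Finite.injective_iff_surjective.2 h.surj
  obtain ⟨c, hc, hclean⟩ := h.guarded {x | f x ≠ x} hf (fun x hx hx' => hx (hinj hx'))
    (fun x hx => hx) (Set.disjoint_empty _)
  replace hclean : Clean L c :=
    hclean.resolve_right fun ⟨a, b, hab, ha, hb⟩ => hab (hinj (ha.trans hb.symm))
  exact ⟨c, hc, h.toRejections, fun x _ => h.surj x,
    fun S hne hS hfix _ => h.guarded S hne hS hfix (Set.disjoint_empty _),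
    fun m x hmx _ => h.fixed m x hmx, fun m hm => absurd hm (hclean m),
    fun m hm => absurd (h.subset _ hm) (hclean m)⟩

/-- If somebody other than `c` points at `c`, then he is blacklisted by `c`. -/
theorem Active.exists_of_surjective {ρ : α → α → ℕ} {c : α} {B : Set (α × α)} {L : List (α × α)}
    {f : α → α} (h : Active ρ c B L f) [Finite α] (hc : f c ≠ c) {m : α} (hm : f m = c)
    (hsurj : Function.Surjective f) :
    ∃ B' f', Active ρ c B' ((m, c) :: L) f' := by
  have hinj : Function.Injective f := Finite.injective_iff_surjective.2 hsurj
  have hmc : m ≠ c := by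
    rintro rfl
    exact hc hm
  have hmfix : f m ≠ m := hm.trans_ne hmc.symm
  obtain ⟨f', hP', hf'm, hf'⟩ := h.points.reject (h.justified.diag_notMem m) hmfix
  rw [hm] at hP' hf'm
  have hfix : ∀ a, f a = a → f' a = a := fun a ha => by
    rw [hf' a, ha]
    rintro rfl
    exact hmfix ha
  have hm_fst : ∀ x, (m, x) ∈ B → x = c := fun x hx => by
    by_contra hxc
    exact hmfix (h.fixed m x hx hxc).1
  -- a set containing `c` and closed under `f'` contains `m`, hence is closed under `f` as well
  have hreach : ∀ S : Set α, Set.MapsTo f' S S → c ∈ S → m ∈ S ∧ Set.MapsTo f S S := by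
    intro S hS hcS
    have hmS : m ∈ S := by
      by_contra hmS
      have hSf : Set.MapsTo f S S := fun a ha => hf' a (fun h => hmS (h ▸ ha)) ▸ hS ha
      obtain ⟨k, hk, hper⟩ := hinj.mem_periodicPts c
      obtain ⟨j, rfl⟩ : ∃ j, k = j + 1 := ⟨k - 1, by omega⟩
      have : f (f^[j] c) = c := by
        rw [← Function.iterate_succ_apply' f j c]
        exact hper
      exact hmS (hinj (hm.trans this.symm) ▸ hSf.iterate j hcS)
    refine ⟨hmS, fun a ha => ?_⟩
    by_cases ham : a = m
    · exact ham ▸ hm.symm ▸ hcS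
    · exact hf' a ham ▸ hS ha
  refine ⟨insert (m, c) B, f', ⟨.cons (h.justified.insert h.mem_of_mem m) (hm ▸ (h.points m).1) hmc
    (Or.inl (Set.mem_insert _ _)), hP', ?_, ?_, ?_⟩, ?_, ?_, ?_, ?_, ?_⟩
  · rintro p (rfl | hp)
    · exact List.mem_cons_self
    · exact List.mem_cons_of_mem _ (h.subset p hp)
  · rintro a x y (hx | hx) (hy | hy)
    · exact (congrArg Prod.snd hx).trans (congrArg Prod.snd hy).symm
    · simp only [Prod.mk.injEq] at hx
      rw [hx.2, hm_fst y (hx.1 ▸ hy)]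
    · simp only [Prod.mk.injEq] at hy
      rw [hy.2, hm_fst x (hy.1 ▸ hx)]
    · exact h.fst_inj a x y hx hy
  · rintro a x y (hx | hx) (hy | hy)
    · simp only [Prod.mk.injEq] at hx hy
      exact hmc (hy.1.symm.trans hx.2)
    · simp only [Prod.mk.injEq] at hx
      rw [hx.2] at hy
      by_cases hyc : y = c
      · exact h.justified.diag_notMem c (h.subset _ (hyc ▸ hy))
      · exact hc (h.fixed c y hy hyc).1
    · simp only [Prod.mk.injEq] at hy
      rw [hy.1] at hx
      exact hmfix (h.fixed a m hx hmc).2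
    · exact h.fst_notMem_snd a x y hx hy
  · intro x hx
    obtain ⟨a, ha⟩ := h.mem_range x hx
    exact ⟨a, (hf' a (by rintro rfl; exact hx (ha.symm.trans hm))).trans ha⟩
  · exact h.guarded.reject (fun x hx _ => h.mem_range x hx) hm (Or.inl rfl) hf'm hf'
  · rintro a x (hx | hx) hxc
    · exact absurd (congrArg Prod.snd hx) hxc
    · exact (h.fixed a x hx hxc).imp (hfix a) (hfix x)
  · intro a ha
    rcases List.mem_cons.1 ha with ha | ha
    · exact ha ▸ Set.mem_insert _ _
    · exact Set.mem_insert_of_mem _ (h.mem_of_mem a ha)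
  · rintro a (ha | ha)
    · obtain rfl := congrArg Prod.fst ha
      exact Or.inr fun S hS hcS => (hreach S hS hcS).1
    · exact (h.reach a ha).imp (hfix a) fun hr S hS hcS => hr S (hreach S hS hcS).2 hcS

/-- If nobody points at `c`, then there is a collision elsewhere, which is resolved without
blacklisting. -/
theorem Active.exists_of_collision {ρ : α → α → ℕ} {c : α} {B : Set (α × α)} {L : List (α × α)}
    {f : α → α} (h : Active ρ c B L f) [Finite α] (hc : ∀ a, f a ≠ c) :
    ∃ p B' f', Active ρ c B' (p :: L) f' := by
  have hninj : ¬ Function.Injective f := fun hinj => by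
    obtain ⟨a, ha⟩ := Finite.injective_iff_surjective.1 hinj c
    exact hc a ha
  obtain ⟨a, b, hfab, hab⟩ : ∃ a b, f a = f b ∧ a ≠ b := by
    simpa [Function.Injective] using hninj
  obtain ⟨y, hy⟩ : ∃ y, f b = y := ⟨_, rfl⟩
  obtain ⟨m, m', hmm', hmy, hm, hm', hbr⟩ := exists_breaksCycle hab (hfab.trans hy) hy
  have hmfix : f m ≠ m := hm.trans_ne hmy.symm
  have hyc : y ≠ c := hy ▸ hc b
  obtain ⟨f', hP', hf'm, hf'⟩ := h.points.reject (h.justified.diag_notMem m) hmfix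
  rw [hm] at hP' hf'm
  have hfix : ∀ a, f a = a → f' a = a := fun a ha => by
    rw [hf' a, ha]
    rintro rfl
    exact hmfix ha
  have hrange : ∀ x, x ≠ c → ∃ a, a ≠ m ∧ f a = x := by
    intro x hx
    by_cases hxy : x = y
    · exact ⟨m', hmm'.symm, hm'.trans hxy.symm⟩
    · obtain ⟨a, ha⟩ := h.mem_range x hx
      exact ⟨a, by rintro rfl; exact hxy (ha.symm.trans hm), ha⟩
  refine ⟨(m, y), B, f', ⟨h.justified.cons_of_collision h.points h.subset hmm' hmy hm hm', hP',
    fun p hp => List.mem_cons_of_mem _ (h.subset p hp), h.fst_inj, h.fst_notMem_snd⟩, ?_,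
    h.guarded.reject (fun x hx _ => h.mem_range x hx) hm (Or.inr hbr) hf'm hf',
    fun a x hx hxc => (h.fixed a x hx hxc).imp (hfix a) (hfix x), ?_, ?_⟩
  · intro x hx
    obtain ⟨a, ham, ha⟩ := hrange x hx
    exact ⟨a, (hf' a ham).trans ha⟩
  · intro a ha
    rcases List.mem_cons.1 ha with ha | ha
    · exact absurd (congrArg Prod.snd ha).symm hyc
    · exact h.mem_of_mem a ha
  · intro a ha
    by_cases hfa : f a = a
    · exact Or.inl (hfix a hfa)
    refine Or.inr fun S hS hcS => ?_
    have hr := (h.reach a ha).resolve_left hfa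
    by_contra haS
    have hmS : m ∈ S := by
      by_contra hmS
      exact haS (hr S (fun a ha => hf' a (fun h => hmS (h ▸ ha)) ▸ hS ha) hcS)
    have hyS : y ∉ S := fun hyS => haS (hr S (fun a ha => by
      by_cases ham : a = m
      · exact ham ▸ hm.symm ▸ hyS
      · exact hf' a ham ▸ hS ha) hcS)
    -- every node outside `S` has a preimage outside `S`, so `f` permutes the complement of `S`;
    -- then `y` is periodic there, although its predecessor `m` is in `S`
    have hsub : Sᶜ ⊆ f '' Sᶜ := fun x hx => by
      obtain ⟨a, ham, rfl⟩ := hrange x fun h => hx (h ▸ hcS)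
      exact ⟨a, fun haS => hx (hf' a ham ▸ hS haS), rfl⟩
    have himage : f '' Sᶜ = Sᶜ :=
      (Set.eq_of_subset_of_ncard_le hsub (Set.ncard_image_le (Set.toFinite _))).symm
    have hmaps : Set.MapsTo f Sᶜ Sᶜ := fun x hx => himage ▸ Set.mem_image_of_mem f hx
    rcases hbr with hfy | hcyc | hper
    · have : a ∈ insert y S := hr _ (by
        rintro x (rfl | hx)
        · exact Or.inl hfy
        · by_cases hxm : x = m
          · exact Or.inl (hxm ▸ hm)
          · exact Or.inr (hf' x hxm ▸ hS hx)) (Or.inr hcS)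
      rcases this with rfl | h
      · exact hfa hfy
      · exact haS h
    · exact hcyc _ hmaps hyS hmS
    · have hsurj : Function.Surjective (hmaps.restrict f Sᶜ Sᶜ) :=
        (Set.MapsTo.restrict_surjective_iff hmaps).2 hsub
      obtain ⟨k, hk, hp⟩ := (Finite.injective_iff_surjective.2 hsurj).mem_periodicPts ⟨y, hyS⟩
      refine hper ⟨k, hk, ?_⟩
      have := congrArg Subtype.val hp
      rwa [hmaps.coe_iterate_restrict] at this

theorem Active.exists_cons {ρ : α → α → ℕ} {c : α} {B : Set (α × α)} {L : List (α × α)}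
    {f : α → α} (h : Active ρ c B L f) [Finite α] (hc : f c ≠ c) :
    ∃ p B' f', Active ρ c B' (p :: L) f' := by
  by_cases hr : ∃ m, f m = c
  · obtain ⟨m, hm⟩ := hr
    exact ⟨(m, c), h.exists_of_surjective hc hm fun x =>
      (eq_or_ne x c).elim (fun hx => ⟨m, hm.trans hx.symm⟩) (h.mem_range x)⟩
  · exact h.exists_of_collision fun a ha => hr ⟨a, ha⟩

/-- The run ends with every man pointing at his own partner. -/
theorem exists_rejections [Fintype α] (ρ : α → α → ℕ) : ∃ B L, Rejections ρ B L id := by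
  have main : ∀ k, ∀ c B L f, Fintype.card (α × α) < L.length + k → Active ρ c B L f →
      f c ≠ c → ∃ B L, Rejections ρ B L id := by
    intro k
    induction k with
    | zero => exact fun _ _ L f hk h => absurd h.justified.nodup.length_le_card (not_le.2 hk)
    | succ k ih =>
      intro c B L f hk h hc
      obtain ⟨p, B', f', h'⟩ := h.exists_cons hc
      have hk' : Fintype.card (α × α) < (p :: L).length + k := by
        rw [List.length_cons]
        omega
      by_cases hc' : f' c = c
      · have hrest := h'.resting hc'
        by_cases hf' : ∃ x, f' x ≠ x
        · obtain ⟨c', hne, hact⟩ := hrest.exists_active hf'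
          exact ih c' B' _ f' hk' hact hne
        · obtain rfl : f' = id := funext fun x => not_not.1 fun hx => hf' ⟨x, hx⟩
          exact ⟨B', _, hrest.toRejections⟩
      · exact ih c B' _ f' hk' h' hc'
  obtain ⟨L, f, h⟩ := exists_resting ρ
  by_cases hf : ∃ x, f x ≠ x
  · obtain ⟨c, hc, hact⟩ := h.exists_active hf
    exact main (Fintype.card (α × α) + 1) c ∅ L f (by omega) hact hc
  · obtain rfl : f = id := funext fun x => not_not.1 fun hx => hf ⟨x, hx⟩
    exact ⟨∅, L, h.toRejections⟩

/-! ### Preference lists -/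

/-- Sort the elements of `S` by `key`; ties are broken arbitrarily. -/
theorem PrefList.exists_of_key {B : Type*} [Finite B] (S : Set B) (key : B → ℕ) :
    ∃ P : PrefList B, (∀ b, b ∈ P.toList ↔ b ∈ S) ∧
      ∀ a b, a ∈ S → key a < key b → P.Prefers a b := by
  classical
  have hS : S.Finite := S.toFinite
  let r : B → B → Prop := fun a b => key a ≤ key b
  have : Std.Total r := ⟨fun a b => le_total (key a) (key b)⟩
  have : IsTrans B r := ⟨fun a b c => le_trans⟩
  let l := hS.toFinset.toList.insertionSort r
  have hperm : l.Perm hS.toFinset.toList := List.perm_insertionSort r _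
  have hmem : ∀ b, b ∈ l ↔ b ∈ S := fun b => by simp [hperm.mem_iff]
  have hsorted : l.Pairwise r := List.pairwise_insertionSort r _
  refine ⟨⟨l, hperm.nodup_iff.2 (Finset.nodup_toList _)⟩, hmem, fun a b ha hab => ?_⟩
  have hal : l.idxOf a < l.length := List.idxOf_lt_length_iff.2 ((hmem a).2 ha)
  have : l.idxOf a < l.idxOf b := by
    by_contra hle
    rcases (not_lt.1 hle).lt_or_eq with hlt | heq
    · have := List.pairwise_iff_getElem.1 hsorted _ _ (hlt.trans hal) hal hlt
      rw [List.getElem_idxOf, List.getElem_idxOf] at this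
      exact absurd this (not_le.2 hab)
    · have hbl : b ∈ l := List.idxOf_lt_length_iff.1 (heq ▸ hal)
      rw [(List.idxOf_inj hbl).1 heq] at hab
      exact lt_irrefl _ hab
  exact this

theorem mem_blacklist {A B : Type*} [Fintype B] {P : Profile A B} {a : A} {b : B} :
    b ∈ blacklist P a ↔ b ∉ (P a).toList := by
  simp [blacklist]

/-- The position of the partner `e x` of `x` in the list of `m`. Women blacklisted by `m` all have the
length of the list as their rank, which is larger than the rank of any listed woman. -/
noncomputable def rank {W M : Type*} (PM : Profile M W) (e : M ≃ W) (m x : M) : ℕ :=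
  open Classical in (PM m).toList.idxOf (e x)

/-- The key by which the partner of `x` sorts the men: first `x`, then the men she has not rejected,
then the rejected men, the latest first (as in `L`). -/
noncomputable def rejectionKey {α : Type*} (L : List (α × α)) (x m : α) : ℕ :=
  open Classical in if m = x then 0 else if (m, x) ∈ L then 2 + L.idxOf (m, x) else 1

theorem rejectionKey_self_lt {α : Type*} (L : List (α × α)) {x m : α} (h : m ≠ x) :
    rejectionKey L x x < rejectionKey L x m := by
  unfold rejectionKey
  simp only [h, if_true, if_false]
  split_ifs <;> omega

/-- At the time `x` rejects `m`, any other man `m'` not yet rejected by `x` is preferred by her to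
`m`, whether she rejects `m'` later or never. -/
theorem rejectionKey_lt {α : Type*} {L₁ L₂ : List (α × α)} {x m m' : α}
    (hnodup : (L₁ ++ (m, x) :: L₂).Nodup) (hmx : m ≠ x) (hm' : m' ≠ m) (h : (m', x) ∉ L₂) :
    rejectionKey (L₁ ++ (m, x) :: L₂) x m' < rejectionKey (L₁ ++ (m, x) :: L₂) x m := by
  classical
  have hm : (m, x) ∉ L₁ := fun h => by
    have := List.disjoint_of_nodup_append hnodup h
    exact this List.mem_cons_self
  have h1 : (L₁ ++ (m, x) :: L₂).idxOf (m, x) = L₁.length := by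
    rw [List.idxOf_append_of_notMem hm, List.idxOf_cons_self, add_zero]
  have h2 : (m', x) ∈ L₁ ++ (m, x) :: L₂ →
      (L₁ ++ (m, x) :: L₂).idxOf (m', x) < L₁.length := fun hmem => by
    have : (m', x) ∈ L₁ := by simpa [hm', h] using hmem
    rw [List.idxOf_append_of_mem this]
    exact List.idxOf_lt_length_iff.2 this
  have hmem : (m, x) ∈ L₁ ++ (m, x) :: L₂ := by simp
  have hkey : rejectionKey (L₁ ++ (m, x) :: L₂) x m = 2 + L₁.length := by
    unfold rejectionKey
    rw [if_neg hmx, if_pos hmem]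
    convert congrArg (2 + ·) h1
  rw [hkey]
  unfold rejectionKey
  split_ifs with h3 h4
  · omega
  · have := h2 h4
    convert Nat.add_lt_add_left this 2
  · omega

theorem exists_equiv_of_isPerfect {W M : Type*} {μ : Matching W M} (h : IsPerfect μ) :
    ∃ e : M ≃ W, ∀ w m, μ w = some m ↔ e m = w := by
  choose g hg using h.1
  choose k hk using h.2
  have hk' : ∀ m, μ (k m) = some m := fun m => μ.eq_some_iff.1 (hk m)
  refine ⟨⟨k, g, fun m => ?_, fun w => ?_⟩, fun w m => ⟨fun hw => ?_, ?_⟩⟩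
  · exact Option.some.inj ((hg _).symm.trans (hk' m))
  · exact Option.some.inj ((hk _).symm.trans (μ.eq_some_iff.2 (hg w)))
  · exact Option.some.inj ((hk m).symm.trans (μ.eq_some_iff.2 hw))
  · rintro rfl
    exact hk' m

theorem mem_toList_of_rank_le {W M : Type*} [Fintype W] {PM : Profile M W} {μ : Matching W M}
    {e : M ≃ W} (he : ∀ w m, μ w = some m ↔ e m = w)
    (hrational : IsRational PM μ.symm) {m x : M} (h : rank PM e m x ≤ rank PM e m m) :
    e x ∈ (PM m).toList := by
  classical
  have hm : e m ∈ (PM m).toList := by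
    have := hrational m (e m) (μ.eq_some_iff.2 ((he _ _).2 rfl))
    rwa [mem_blacklist, not_not] at this
  refine List.idxOf_lt_length_iff.1 (lt_of_le_of_lt ?_ (List.idxOf_lt_length_iff.2 hm))
  unfold rank at h
  convert h

theorem prefers_of_rank_le {W M : Type*} {PM : Profile M W} {e : M ≃ W} {m x : M} {w : W}
    (hx : e x ∈ (PM m).toList) (hw : w ≠ e x)
    (h : rank PM e m x ≤ rank PM e m (e.symm w)) : (PM m).Prefers (e x) w := by
  classical
  unfold rank at h
  rw [e.apply_symm_apply] at h
  unfold PrefList.Prefers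
  exact lt_of_le_of_ne h fun heq => hw ((List.idxOf_inj hx).1 heq).symm

section

/-! ### Uniqueness of the stable matching -/

variable {W M : Type*} [Fintype W] [Fintype M] {PM : Profile M W} {PW : Profile W M}
  {μ σ : Matching W M} {e : M ≃ W} {B : Set (M × M)} {L : List (M × M)}

theorem IsStable.of_top_choice (he : ∀ w m, μ w = some m ↔ e m = w)
    (hrational : IsRational PM μ.symm) (hmem : ∀ m, m ∈ (PW (e m)).toList)
    (htop : ∀ m a, a ≠ m → (PW (e m)).Prefers m a) : IsStable PW PM μ := by
  rintro (h | h | ⟨w, m, -, -, hw, -⟩)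
  · exact h fun w m hm => mem_blacklist.not.2 (not_not.2 ((he w m).1 hm ▸ hmem m))
  · exact h hrational
  · have hμ : μ w = some (e.symm w) := (he _ _).2 (e.apply_symm_apply w)
    rcases hw with hw | ⟨b, hb, hp⟩
    · simp [hw] at hμ
    · obtain rfl : e.symm w = b := Option.some.inj (hμ.symm.trans hb)
      by_cases hm : m = e.symm w
      · exact lt_irrefl _ (hm ▸ hp)
      · have := htop _ m hm
        rw [e.apply_symm_apply] at this
        exact lt_asymm hp this

/-- In a stable matching each man is matched at least as well as in `μ`, because he and his partner
under `μ`, whose first choice he is, would block otherwise. -/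
theorem IsStable.exists_partner (hσ : IsStable PW PM σ) (he : ∀ w m, μ w = some m ↔ e m = w)
    (hrational : IsRational PM μ.symm) (hmem : ∀ m, m ∈ (PW (e m)).toList)
    (htop : ∀ m a, a ≠ m → (PW (e m)).Prefers m a) (m : M) :
    ∃ w, σ.symm m = some w ∧ rank PM e m (e.symm w) ≤ rank PM e m m := by
  by_contra! hcon
  have hm : e m ∈ (PM m).toList := mem_toList_of_rank_le he hrational le_rfl
  refine hσ (Or.inr (Or.inr ⟨e m, m, mem_blacklist.not.2 (not_not.2 (hmem m)),
    mem_blacklist.not.2 (not_not.2 hm), ?_, ?_⟩))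
  · rcases hσm : σ (e m) with _ | a
    · exact Or.inl hσm
    · refine Or.inr ⟨a, hσm, htop m a ?_⟩
      rintro rfl
      have := hcon (e a) (σ.eq_some_iff.2 hσm)
      simp at this
  · rcases hσm : σ.symm m with _ | w
    · exact Or.inl hσm
    · have := hcon w hσm
      refine Or.inr ⟨w, hσm, prefers_of_rank_le hm ?_ this.le⟩
      rintro rfl
      simp at this

/-- No rejected pair occurs in a stable matching `σ`. If `a` and `y` were matched, let `m'` justify the
rejection: everybody `m'` likes better than `y` has rejected him earlier, so by induction his
partner in `σ` is worse than `y`, and `y` prefers him to `a`. -/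
theorem IsStable.ne_of_mem (hσ : IsStable PW PM σ) (he : ∀ w m, μ w = some m ↔ e m = w)
    (hrational : IsRational PM μ.symm) (hmem : ∀ x m, m ∈ (PW (e x)).toList ↔ (m, x) ∉ B)
    (hpref : ∀ x a b, (a, x) ∉ B → rejectionKey L x a < rejectionKey L x b →
      (PW (e x)).Prefers a b)
    (hpartner : ∀ m, ∃ w, σ.symm m = some w)
    {L₁ L₂ : List (M × M)} (hL : L = L₁ ++ L₂) (hnodup : L.Nodup)
    (hJ : Justified (rank PM e) B L₂) :
    ∀ m x, (m, x) ∈ L₂ → σ (e x) ≠ some m := by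
  induction hJ generalizing L₁ with
  | nil => simp
  | @cons L₂ m x hJ hn hmx hw ih =>
    have ih' := ih (L₁ := L₁ ++ [(m, x)]) (by simpa using hL)
    intro a y hay
    rcases List.mem_cons.1 hay with hay | hay
    swap
    · exact ih' a y hay
    simp only [Prod.mk.injEq] at hay
    obtain ⟨rfl, rfl⟩ := hay
    intro hσa
    have haB : (a, y) ∉ B := by
      have : IsRational PW σ := by
        by_contra h
        exact hσ (Or.inl h)
      rw [← hmem, ← not_not (a := _ ∈ _), ← mem_blacklist]
      exact this _ _ hσa
    obtain ⟨m', hne, hm'L, hm'B, hacc, hbest⟩ := hw.resolve_left haB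
    obtain ⟨w, hw⟩ := hpartner m'
    have hσw : σ w = some m' := σ.eq_some_iff.1 hw
    have hwy : w ≠ e y := by
      rintro rfl
      exact hne (Option.some.inj (hσw.symm.trans hσa))
    have hey : e y ∈ (PM m').toList := mem_toList_of_rank_le he hrational hacc
    refine hσ (Or.inr (Or.inr ⟨e y, m', mem_blacklist.not.2 (not_not.2 ((hmem _ _).2 hm'B)),
      mem_blacklist.not.2 (not_not.2 hey), Or.inr ⟨a, hσa, hpref _ _ _ hm'B ?_⟩,
      Or.inr ⟨w, hw, prefers_of_rank_le hey hwy ?_⟩⟩))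
    · subst hL
      exact rejectionKey_lt hnodup hmx hne hm'L
    · by_contra hlt
      refine ih' m' (e.symm w) (hbest _ (not_le.1 hlt)) ?_
      rwa [e.apply_symm_apply]

theorem isStable_iff_eq (he : ∀ w m, μ w = some m ↔ e m = w)
    (hrational : IsRational PM μ.symm) (hR : Rejections (rank PM e) B L id)
    (hmem : ∀ x m, m ∈ (PW (e x)).toList ↔ (m, x) ∉ B)
    (hpref : ∀ x a b, (a, x) ∉ B → rejectionKey L x a < rejectionKey L x b →
      (PW (e x)).Prefers a b) :
    IsStable PW PM σ ↔ σ = μ := by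
  have hB : ∀ m, (m, m) ∉ B := fun m h => hR.justified.diag_notMem m (hR.subset _ h)
  have hmem' : ∀ m, m ∈ (PW (e m)).toList := fun m => (hmem m m).2 (hB m)
  have htop : ∀ m a, a ≠ m → (PW (e m)).Prefers m a := fun m a ha =>
    hpref m m a (hB m) (rejectionKey_self_lt L ha)
  refine ⟨fun hσ => ?_, ?_⟩
  · have hpartner := hσ.exists_partner he hrational hmem' htop
    have hne := hσ.ne_of_mem he hrational hmem hpref (fun m => (hpartner m).imp fun _ h => h.1)
      (L₁ := []) rfl hR.justified.nodup hR.justified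
    have hsymm : ∀ m, σ.symm m = some (e m) := fun m => by
      obtain ⟨w, hw, hle⟩ := hpartner m
      have hwe : w = e m := by
        by_contra hwe
        refine hne m (e.symm w) (hR.points.mem (lt_of_le_of_ne hle fun heq => ?_)) ?_
        · have := prefers_of_rank_le (mem_toList_of_rank_le he hrational le_rfl) hwe heq.ge
          unfold rank at heq
          rw [e.apply_symm_apply] at heq
          exact this.ne heq.symm
        · rw [e.apply_symm_apply]
          exact σ.eq_some_iff.1 hw
      rw [hw, hwe]
    ext w m
    refine ⟨fun h => ?_, fun h => ?_⟩
    · exact (he w m).2 (Option.some.inj ((hsymm m).symm.trans (σ.eq_some_iff.2 h)))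
    · exact σ.eq_some_iff.1 ((hsymm m).trans (congrArg some ((he w m).1 h)))
  · rintro rfl
    exact .of_top_choice he hrational hmem' htop

/-! ### The sizes of the blacklists -/

theorem mem_blacklist_iff {W M : Type*} [Fintype M] {PW : Profile W M} {e : M ≃ W}
    {B : Set (M × M)} (hmem : ∀ x m, m ∈ (PW (e x)).toList ↔ (m, x) ∉ B) {w : W} {m : M} :
    m ∈ blacklist PW w ↔ (m, e.symm w) ∈ B := by
  have := hmem (e.symm w) m
  rw [e.apply_symm_apply] at this
  rw [mem_blacklist, this, not_not]

theorem disjoint_blacklist {W M : Type*} [Fintype M] {PM : Profile M W} {PW : Profile W M}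
    {e : M ≃ W} {B : Set (M × M)} {L : List (M × M)} (hR : Rejections (rank PM e) B L id)
    (hmem : ∀ x m, m ∈ (PW (e x)).toList ↔ (m, x) ∉ B) {w₁ w₂ : W} (hw : w₁ ≠ w₂) :
    Disjoint (blacklist PW w₁) (blacklist PW w₂) :=
  Finset.disjoint_left.2 fun m h1 h2 => hw (e.symm.injective
    (hR.fst_inj m _ _ ((mem_blacklist_iff hmem).1 h1) ((mem_blacklist_iff hmem).1 h2)))

/-- The blacklisted men and the partners of the women with nonempty blacklists are disjoint sets
of men. -/
theorem card_blacklists (hR : Rejections (rank PM e) B L id)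
    (hmem : ∀ x m, m ∈ (PW (e x)).toList ↔ (m, x) ∉ B) :
    combinedSize PW + numNonempty PW ≤ Fintype.card M ∧ numNonempty PW ≤ combinedSize PW := by
  classical
  set N := Finset.univ.filter fun w => (blacklist PW w).Nonempty with hN
  have hnum : numNonempty PW = N.card := by
    unfold numNonempty
    convert rfl
  have hsize : combinedSize PW = (Finset.univ.biUnion (blacklist PW)).card :=
    (Finset.card_biUnion fun w₁ _ w₂ _ hw => disjoint_blacklist hR hmem hw).symm
  constructor
  · rw [hsize, hnum, ← Finset.card_map e.symm.toEmbedding, ← Finset.card_union_of_disjoint]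
    · exact Finset.card_le_univ _
    · refine Finset.disjoint_left.2 fun m hm hm' => ?_
      obtain ⟨w, -, hw⟩ := Finset.mem_biUnion.1 hm
      obtain ⟨v, hv, rfl⟩ := Finset.mem_map.1 hm'
      obtain ⟨a, ha⟩ := (Finset.mem_filter.1 hv).2
      exact hR.fst_notMem_snd a _ _ ((mem_blacklist_iff hmem).1 ha)
        ((mem_blacklist_iff hmem).1 hw)
  · rw [hnum, Finset.card_eq_sum_ones]
    exact (Finset.sum_le_sum fun w hw => Finset.card_pos.2 (Finset.mem_filter.1 hw).2).trans
      (Finset.sum_le_sum_of_subset (Finset.subset_univ N))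

end

end StableMatching

open StableMatching in
theorem mainTheorem2 {W M : Type*} [Fintype W] [Fintype M] [Nonempty W]
    (n : ℕ) (hW : Fintype.card W = n) (hM : Fintype.card M = n)
    (PM : StableMatching.Profile M W) (μ : StableMatching.Matching W M)
    (hperfect : StableMatching.IsPerfect μ)
    (hrational : StableMatching.IsRational PM μ.symm) :
    ∃ PW : StableMatching.Profile W M,
      -- the only stable matching is `μ`
      (∀ ν : StableMatching.Matching W M, StableMatching.IsStable PW PM ν ↔ ν = μ) ∧
      -- the blacklists of the women are pairwise disjoint
      (∀ w₁ w₂ : W, w₁ ≠ w₂ →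
        Disjoint (StableMatching.blacklist PW w₁) (StableMatching.blacklist PW w₂)) ∧
      -- at most half of the women have nonempty blacklists
      StableMatching.numNonempty PW ≤ n / 2 ∧
      StableMatching.combinedSize PW ≤ n - StableMatching.numNonempty PW ∧
      -- the combined size is at most `n - 1`, so that the average size is less than `1`
      StableMatching.combinedSize PW ≤ n - 1 ∧
      (StableMatching.combinedSize PW : ℚ) / (n : ℚ) < 1 := by
  obtain ⟨e, he⟩ := exists_equiv_of_isPerfect hperfect
  obtain ⟨B, L, hR⟩ := exists_rejections (rank PM e)
  choose PW hmem hpref using fun w : W =>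
    PrefList.exists_of_key {m | (m, e.symm w) ∉ B} (rejectionKey L (e.symm w))
  have hmem' : ∀ x m, m ∈ (PW (e x)).toList ↔ (m, x) ∉ B := fun x m => by
    simpa using hmem (e x) m
  have hpref' : ∀ x a b, (a, x) ∉ B → rejectionKey L x a < rejectionKey L x b →
      (PW (e x)).Prefers a b := fun x a b h1 h2 => hpref (e x) a b (by simpa using h1)
        (by simpa using h2)
  have hn : 0 < n := hW ▸ Fintype.card_pos
  obtain ⟨h1, h2⟩ := card_blacklists hR hmem'
  rw [hM] at h1
  -- if nobody has a nonempty blacklist, the combined size is `0`; otherwise `n_b ≥ 1`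
  have hsize : combinedSize PW ≤ n - 1 := by
    rcases Nat.eq_zero_or_pos (numNonempty PW) with h0 | h0
    · have : combinedSize PW = 0 := Finset.sum_eq_zero fun w _ => by
        have hw := Finset.card_eq_zero.1 h0
        exact Finset.card_eq_zero.2 (Finset.not_nonempty_iff_eq_empty.1
          (Finset.filter_eq_empty_iff.1 hw (Finset.mem_univ w)))
      omega
    · omega
  refine ⟨PW, fun ν => isStable_iff_eq he hrational hR hmem' hpref',
    fun w₁ w₂ => disjoint_blacklist hR hmem', by omega, by omega, hsize, ?_⟩
  rw [div_lt_one (by exact_mod_cast hn)]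
  exact_mod_cast (show combinedSize PW < n by omega)
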